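/- Let $X$ be a projective variety of positive dimension over a field $k$ (an integral $k$-scheme admitting a closed immersion over $k$ into some $\mathbb{P}^n_k$), and let $D_1,\ldots,D_q$ be ample effective Cartier divisors on $X$. Let $\operatorname{Div}(X)$ be the group of Cartier divisors on $X$, with no equivalence relation imposed, and let $r$ be the rank of the subgroup of $\operatorname{Div}(X)$ generated by $D_1,\ldots,D_q$. Then for every subvariety (irreducible closed subset) $W\subset X$ with $\dim W\geq r$, $$\bigcap_{i=1}^q \operatorname{Supp} D_i\cap W\neq\emptyset .$$ In particular, if $r\leq \dim X$, then $\bigcap_{i=1}^q \operatorname{Supp} D_i\neq\emptyset$. -/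

import Mathlib

open AlgebraicGeometry CategoryTheory

universe u

noncomputable section

section ProjectiveSpace

attribute [local instance] MvPolynomial.gradedAlgebra

/-- The projective space `ℙⁿ` over a field `k`, that is, `Proj k[x₀, …, xₙ]` with the usual
grading by degree. -/
def projSpace (k : Type u) [Field k] (n : ℕ) : Scheme.{u} :=
  Proj (MvPolynomial.homogeneousSubmodule (Fin (n + 1)) k)

/-- The structure morphism `ℙⁿ ⟶ Spec k`. -/
def projSpaceToSpec (k : Type u) [Field k] (n : ℕ) : projSpace k n ⟶ Spec (CommRingCat.of k) :=
  Proj.toSpecZero (MvPolynomial.homogeneousSubmodule (Fin (n + 1)) k) ≫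
    Spec.map (CommRingCat.ofHom
      (algebraMap k (MvPolynomial.homogeneousSubmodule (Fin (n + 1)) k 0)))

/-- A `k`-scheme `π : X ⟶ Spec k` is projective if it admits a closed immersion over `k` into
some projective space `ℙⁿ` over `k`. -/
def IsProjectiveOver {k : Type u} [Field k] {X : Scheme.{u}}
    (π : X ⟶ Spec (CommRingCat.of k)) : Prop :=
  ∃ (n : ℕ) (i : X ⟶ projSpace k n), IsClosedImmersion i ∧ i ≫ projSpaceToSpec k n = π

end ProjectiveSpace

section Divisors

variable (X : Scheme.{u}) [IsIntegral X]

/-- The image of the unit group of the local ring at `x` in the multiplicative group of the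
function field. -/
def localUnits (x : X) : Subgroup (X.functionField)ˣ :=
  (Units.map (algebraMap (X.presheaf.stalk x) X.functionField).toMonoidHom).range

/-- The quotient `K(X)ˣ / 𝒪_{X,x}ˣ`, written additively: the stalk at `x` of the sheaf
`𝒦ˣ / 𝒪ˣ` on the integral scheme `X`. -/
abbrev LocalDivisor (x : X) : Type u :=
  Additive ((X.functionField)ˣ ⧸ localUnits X x)

variable {X} in
/-- The class in `K(X)ˣ / 𝒪_{X,x}ˣ` of a nonzero rational function. -/
def localClass (x : X) (f : (X.functionField)ˣ) : LocalDivisor X x :=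
  Additive.ofMul (QuotientGroup.mk f)

/-- The group `Div(X)` of Cartier divisors on an integral scheme `X`, that is, of global sections
of the quotient sheaf `𝒦ˣ / 𝒪ˣ`: families of elements of the stalks which are locally given by a
single rational function (a local equation).  No equivalence relation is imposed. -/
def cartierDivisors : AddSubgroup (∀ x : X, LocalDivisor X x) where
  carrier := {D | ∀ x : X, ∃ U : X.Opens, x ∈ U ∧
    ∃ f : (X.functionField)ˣ, ∀ y ∈ U, D y = localClass y f}
  zero_mem' := fun _ => ⟨⊤, trivial, 1, fun _ _ => rfl⟩
  add_mem' := by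
    intro D E hD hE x
    obtain ⟨U, hU, f, hf⟩ := hD x
    obtain ⟨V, hV, g, hg⟩ := hE x
    refine ⟨U ⊓ V, ⟨hU, hV⟩, f * g, fun y hy => ?_⟩
    rw [Pi.add_apply, hf y hy.1, hg y hy.2]
    rfl
  neg_mem' := by
    intro D hD x
    obtain ⟨U, hU, f, hf⟩ := hD x
    refine ⟨U, hU, f⁻¹, fun y hy => ?_⟩
    rw [Pi.neg_apply, hf y hy]
    rfl

/-- Cartier divisors on an integral scheme `X`. -/
abbrev CartierDivisor : Type u := cartierDivisors X

variable {X}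

namespace CartierDivisor

/-- `f` is a local equation of `D` at `x`. -/
def IsLocalEquation (D : CartierDivisor X) (x : X) (f : (X.functionField)ˣ) : Prop :=
  D.1 x = localClass x f

/-- A Cartier divisor is effective if at every point it has a local equation which is regular
there. -/
def IsEffective (D : CartierDivisor X) : Prop :=
  ∀ x : X, ∃ f : (X.functionField)ˣ, D.IsLocalEquation x f ∧
    (f : X.functionField) ∈ (algebraMap (X.presheaf.stalk x) X.functionField).range

/-- The support of a Cartier divisor: the points at which a local equation is not a unit of the
local ring. -/
def support (D : CartierDivisor X) : Set X :=
  {x | D.1 x ≠ 0}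

/-- `s` is a global section of the invertible sheaf `𝒪(D)`, the subsheaf of the constant sheaf
`K(X)` whose stalk at `x` is `f⁻¹ 𝒪_{X,x}`, for `f` a local equation of `D` at `x`. -/
def IsGlobalSection (D : CartierDivisor X) (s : X.functionField) : Prop :=
  ∀ (x : X) (f : (X.functionField)ˣ), D.IsLocalEquation x f →
    s * f ∈ (algebraMap (X.presheaf.stalk x) X.functionField).range

/-- The locus where a section `s` of `𝒪(D)` does not vanish, that is, where it generates the stalk
`f⁻¹ 𝒪_{X,x}`. -/
def nonvanishingLocus (D : CartierDivisor X) (s : X.functionField) : Set X :=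
  {x | ∀ f : (X.functionField)ˣ, D.IsLocalEquation x f →
    ∃ v : (X.presheaf.stalk x)ˣ, algebraMap (X.presheaf.stalk x) X.functionField v = s * f}

/-- `D` is ample if the invertible sheaf `L = 𝒪(D)` is: every point of `X` lies in an affine open
subset of the form `X_s` for a global section `s` of a power `L^{⊗ n} = 𝒪(nD)` with `n ≥ 1`
(on a quasi-compact scheme `X`). -/
def IsAmple (D : CartierDivisor X) : Prop :=
  ∀ x : X, ∃ (n : ℕ) (s : X.functionField) (U : X.Opens), 1 ≤ n ∧ (n • D).IsGlobalSection s ∧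
    (U : Set X) = (n • D).nonvanishingLocus s ∧ IsAffineOpen U ∧ x ∈ U

/-- The rank of the subgroup of `Div(X)` generated by a finite family of Cartier divisors. -/
def rk {q : ℕ} (D : Fin q → CartierDivisor X) : ℕ :=
  Module.finrank ℤ (AddSubgroup.closure (Set.range D))

end CartierDivisor

end Divisors

end

/-! Points are ordered by `y ≤ x` iff `y ∈ closure {x}`, so `Order.height w` measures the dimension
of `closure {w}`. Let `G` be generated by the `D i`, and let `trivialAt G w` consist of its members
trivial at `w`. The core is `exists_mem_iInter_support`: if the rank of `trivialAt G w` is at most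
the height of `w`, then `closure {w}` contains a point common to all supports. The induction is on
that rank. If `w` is off the support of `D i`, some `w' ≤ w` on this support loses at most one
dimension (`IsEffective.exists_le_height`). The rank drops too (`finrank_trivialAt_lt`): `D i` is
trivial at `w`, but none of its positive multiples is trivial at `w'`. Ampleness enters only through
`IsAmple.exists_mem_support`: the support meets every positive-dimensional `closure {x}`, since
otherwise that closure would be both affine and proper over `k`, hence a point. -/

/-! ### Ranks of abelian groups. -/

/-- The class of `d` has infinite order in `H' ⧸ H`, so this quotient has positive rank. -/
theorem AddSubgroup.finrank_lt_of_forall_nsmul_notMem {A : Type*} [AddCommGroup A]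
    {H H' : AddSubgroup A} [Module.Finite ℤ H'] (h : H ≤ H') {d : A} (hd : d ∈ H')
    (hn : ∀ n : ℕ, 1 ≤ n → n • d ∉ H) : Module.finrank ℤ H < Module.finrank ℤ H' := by
  let N : Submodule ℤ H' := AddSubgroup.toIntSubmodule (H.addSubgroupOf H')
  have e : Module.finrank ℤ N = Module.finrank ℤ H :=
    LinearEquiv.finrank_eq (AddSubgroup.addSubgroupOfEquivOfLe h).toIntLinearEquiv
  have key := N.finrank_quotient_add_finrank
  have hpos : Module.finrank ℤ (H' ⧸ N) ≠ 0 := by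
    intro h0
    obtain ⟨a, ha, had⟩ := Module.finrank_eq_zero_iff.1 h0 (N.mkQ ⟨d, hd⟩)
    rw [← map_smul, Submodule.mkQ_apply, Submodule.Quotient.mk_eq_zero] at had
    have had' : a • d ∈ H := had
    refine hn a.natAbs (Nat.one_le_iff_ne_zero.2 (Int.natAbs_ne_zero.2 ha)) ?_
    rcases Int.natAbs_eq a with h | h
    · rwa [h, natCast_zsmul] at had'
    · rw [h, neg_smul, natCast_zsmul] at had'
      simpa using H.neg_mem had'
  omega

theorem AddSubgroup.finite_int_of_le {A : Type*} [AddCommGroup A] {H G : AddSubgroup A}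
    [Module.Finite ℤ G] (h : H ≤ G) : Module.Finite ℤ H := by
  have := isNoetherian_of_isNoetherianRing_of_finite ℤ G
  exact Module.Finite.of_injective (AddSubgroup.inclusion h).toIntLinearMap
    (AddSubgroup.inclusion_injective h)

theorem AddSubgroup.finrank_int_le_of_le {A : Type*} [AddCommGroup A] {H G : AddSubgroup A}
    [Module.Finite ℤ G] (h : H ≤ G) : Module.finrank ℤ H ≤ Module.finrank ℤ G :=
  LinearMap.finrank_le_finrank_of_injective (f := (AddSubgroup.inclusion h).toIntLinearMap)
    (AddSubgroup.inclusion_injective h)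

/-! ### Cutting by one equation in a Noetherian local ring. -/

theorem IsLocalRing.exists_le_coheight_of_mem {A : Type*} [CommRing A] [IsLocalRing A]
    [IsNoetherianRing A] (p : PrimeSpectrum A) {n : ℕ} (h : (n : ℕ∞) + 1 ≤ Order.coheight p)
    {a : A} (ha : a ∈ IsLocalRing.maximalIdeal A) :
    ∃ q : PrimeSpectrum A, p ≤ q ∧ a ∈ q.asIdeal ∧ (n : ℕ∞) ≤ Order.coheight q := by
  have h1 : ((n + 1 : ℕ) : WithBot ℕ∞) ≤ ringKrullDim (A ⧸ p.asIdeal) := by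
    rw [ringKrullDim_quotient]
    refine le_trans ?_ (Order.krullDim_le_of_strictMono
      (fun x : Set.Ici p => (⟨x.1, x.2⟩ : PrimeSpectrum.zeroLocus (p.asIdeal : Set A)))
      fun _ _ h => h)
    rw [← Order.coheight_eq_krullDim_Ici]
    exact_mod_cast h
  have hloc : IsLocalRing (A ⧸ p.asIdeal) :=
    .of_surjective' (Ideal.Quotient.mk p.asIdeal) Ideal.Quotient.mk_surjective
  let b : A ⧸ p.asIdeal := Ideal.Quotient.mk _ a
  have hb : b ∈ IsLocalRing.maximalIdeal (A ⧸ p.asIdeal) :=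
    have := IsLocalHom.of_surjective (Ideal.Quotient.mk p.asIdeal) Ideal.Quotient.mk_surjective
    fun hu ↦ ha (isUnit_of_map_unit (Ideal.Quotient.mk p.asIdeal) a hu)
  -- Krull: killing one element of the maximal ideal lowers the dimension by at most one.
  have h2 := ringKrullDim_le_ringKrullDim_quotient_add_card ({b} : Finset (A ⧸ p.asIdeal))
    (by simpa [IsLocalRing.ringJacobson_eq_maximalIdeal] using hb)
  rw [Finset.card_singleton, Finset.coe_singleton] at h2
  have h3 : (n : WithBot ℕ∞) ≤ ringKrullDim ((A ⧸ p.asIdeal) ⧸ Ideal.span {b}) := by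
    have := h1.trans h2
    push_cast at this
    exact ENat.WithBot.add_le_add_one_right_iff.1 this
  obtain ⟨l, hl⟩ := Order.le_krullDim_iff.1 h3
  let φ : A →+* (A ⧸ p.asIdeal) ⧸ Ideal.span {b} :=
    (Ideal.Quotient.mk _).comp (Ideal.Quotient.mk _)
  have hφ : Function.Surjective φ :=
    Ideal.Quotient.mk_surjective.comp Ideal.Quotient.mk_surjective
  let l' := l.map (PrimeSpectrum.comap φ) fun P Q hPQ ↦ lt_of_le_of_ne
    (Ideal.comap_mono hPQ.le) fun h ↦ hPQ.ne (PrimeSpectrum.comap_injective_of_surjective φ hφ h)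
  refine ⟨l'.head, ?_, ?_, ?_⟩
  · intro x hx
    change φ x ∈ l.head.asIdeal
    have : φ x = 0 := by simp [φ, Ideal.Quotient.eq_zero_iff_mem.2 hx]
    simp [this]
  · change φ a ∈ l.head.asIdeal
    have : φ a = 0 := Ideal.Quotient.eq_zero_iff_mem.2 (Ideal.mem_span_singleton_self b)
    simp [this]
  · rw [← hl]
    exact Order.length_le_coheight_head (p := l')

/-! ### Properness of projective schemes. -/

section
attribute [local instance] MvPolynomial.gradedAlgebra

theorem bijective_algebraMap_homogeneousSubmodule_zero (k : Type u) [Field k] (n : ℕ) :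
    Function.Bijective (algebraMap k (MvPolynomial.homogeneousSubmodule (Fin (n + 1)) k 0)) := by
  constructor
  · intro a b h
    exact MvPolynomial.C_injective _ _ (congrArg Subtype.val h)
  · rintro ⟨p, hp⟩
    obtain ⟨c, hc⟩ : ∃ c, p = MvPolynomial.C c := by
      rw [MvPolynomial.mem_homogeneousSubmodule, ← MvPolynomial.totalDegree_zero_iff_isHomogeneous,
        MvPolynomial.totalDegree_eq_zero_iff_eq_C] at hp
      exact ⟨_, hp⟩
    exact ⟨c, Subtype.ext hc.symm⟩

instance isProper_projSpaceToSpec (k : Type u) [Field k] (n : ℕ) :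
    IsProper (projSpaceToSpec k n) := by
  let A := MvPolynomial.homogeneousSubmodule (Fin (n + 1)) k
  have hb := bijective_algebraMap_homogeneousSubmodule_zero k n
  have : Algebra.FiniteType (A 0) (MvPolynomial (Fin (n + 1)) k) := by
    have h : (algebraMap k (MvPolynomial (Fin (n + 1)) k)).FiniteType :=
      RingHom.finiteType_algebraMap.2 inferInstance
    exact RingHom.finiteType_algebraMap.1
      (RingHom.FiniteType.of_comp_finiteType (f := algebraMap k (A 0)) h)
  have : IsIso (CommRingCat.ofHom (algebraMap k (A 0))) :=
    (ConcreteCategory.isIso_iff_bijective _).2 hb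
  have : IsProper (Proj.toSpecZero A) := inferInstance
  unfold projSpaceToSpec
  exact MorphismProperty.comp_mem @IsProper _ _ this inferInstance
end

theorem IsProjectiveOver.isProper {k : Type u} [Field k] {X : Scheme.{u}}
    {π : X ⟶ Spec (CommRingCat.of k)} (h : IsProjectiveOver π) : IsProper π := by
  obtain ⟨n, i, hi, rfl⟩ := h
  exact MorphismProperty.comp_mem @IsProper _ _ inferInstance inferInstance

/-! ### Local equations, supports and divisors trivial at a point. -/

section
variable {X : Scheme.{u}} [IsIntegral X]

theorem localClass_eq_iff {x : X} {f g : (X.functionField)ˣ} :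
    localClass x f = localClass x g ↔ f⁻¹ * g ∈ localUnits X x :=
  Additive.ofMul.injective.eq_iff.trans QuotientGroup.eq

theorem localClass_eq_zero_iff {x : X} {f : (X.functionField)ˣ} :
    localClass x f = 0 ↔ f ∈ localUnits X x :=
  Additive.ofMul.injective.eq_iff.trans (QuotientGroup.eq_one_iff f)

theorem localClass_pow (x : X) (f : (X.functionField)ˣ) (n : ℕ) :
    localClass x (f ^ n) = n • localClass x f := rfl

theorem algebraMap_stalkSpecializes {x y : X} (h : x ⤳ y) (a : X.presheaf.stalk y) :
    algebraMap (X.presheaf.stalk x) X.functionField (X.presheaf.stalkSpecializes h a) =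
      algebraMap (X.presheaf.stalk y) X.functionField a := by
  simp only [RingHom.algebraMap_toAlgebra]
  rw [← CommRingCat.comp_apply, TopCat.Presheaf.stalkSpecializes_comp]

theorem algebraMap_stalk_injective (x : X) :
    Function.Injective (algebraMap (X.presheaf.stalk x) X.functionField) :=
  IsFractionRing.injective _ _

theorem localUnits_mono {x y : X} (h : x ⤳ y) : localUnits X y ≤ localUnits X x := by
  rintro _ ⟨v, rfl⟩
  refine ⟨Units.map (X.presheaf.stalkSpecializes h).hom.toMonoidHom v, ?_⟩
  ext
  exact algebraMap_stalkSpecializes h v.1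

theorem mem_localUnits_iff_isUnit {x : X} {f : (X.functionField)ˣ} {a : X.presheaf.stalk x}
    (ha : algebraMap (X.presheaf.stalk x) X.functionField a = f) :
    f ∈ localUnits X x ↔ IsUnit a := by
  constructor
  · rintro ⟨v, rfl⟩
    rw [algebraMap_stalk_injective x (ha.trans rfl : _ = algebraMap _ _ v.1)]
    exact v.isUnit
  · rintro ⟨v, rfl⟩
    exact ⟨v, Units.ext ha⟩

theorem exists_opens_forall_mem_localUnits {x : X} {f : (X.functionField)ˣ}
    (hf : f ∈ localUnits X x) : ∃ U : X.Opens, x ∈ U ∧ ∀ y ∈ U, f ∈ localUnits X y := by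
  obtain ⟨v, rfl⟩ := hf
  obtain ⟨U, hxU, s, hs⟩ := X.presheaf.exists_germ_eq v.1
  have hx : x ∈ X.basicOpen s := by
    rw [Scheme.mem_basicOpen _ _ _ hxU, hs]
    exact v.isUnit
  refine ⟨X.basicOpen s, hx, fun y hy ↦ ?_⟩
  have hyU : y ∈ U := X.basicOpen_le s hy
  have : Nonempty U := ⟨⟨x, hxU⟩⟩
  refine (mem_localUnits_iff_isUnit (a := X.presheaf.germ U y hyU s) ?_).2
    ((Scheme.mem_basicOpen _ _ _ hyU).1 hy)
  rw [Scheme.algebraMap_germ_eq_germToFunctionField,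
    ← Scheme.algebraMap_germ_eq_germToFunctionField X hxU, hs]
  rfl

namespace CartierDivisor

variable {D : CartierDivisor X}

theorem notMem_support {x : X} : x ∉ D.support ↔ D.1 x = 0 := not_not

theorem IsLocalEquation.mem_support_iff {x : X} {f : (X.functionField)ˣ}
    (h : D.IsLocalEquation x f) : x ∈ D.support ↔ f ∉ localUnits X x := by
  change D.1 x ≠ 0 ↔ _
  rw [h, Ne, localClass_eq_zero_iff]

theorem IsLocalEquation.of_specializes {x y : X} {f : (X.functionField)ˣ}
    (hf : D.IsLocalEquation y f) (h : x ⤳ y) : D.IsLocalEquation x f := by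
  obtain ⟨U, hU, g, hg⟩ := D.2 y
  have := localClass_eq_iff.1 ((hg y hU).symm.trans hf)
  exact (hg x (h.mem_open U.2 hU)).trans (localClass_eq_iff.2 (localUnits_mono h this))

theorem eq_zero_of_specializes {x y : X} (h : x ⤳ y) (hy : D.1 y = 0) : D.1 x = 0 :=
  IsLocalEquation.of_specializes (D := D) (f := 1) hy h

variable (D) in
theorem isClosed_support : IsClosed D.support := by
  rw [← isOpen_compl_iff, isOpen_iff_forall_mem_open]
  intro x hx
  obtain ⟨U, hU, f, hf⟩ := D.2 x
  have hD : D.1 x = 0 := notMem_support.1 hx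
  rw [hf x hU, localClass_eq_zero_iff] at hD
  obtain ⟨V, hV, hfV⟩ := exists_opens_forall_mem_localUnits hD
  refine ⟨U ⊓ V, fun y hy ↦ ?_, (U ⊓ V).2, hU, hV⟩
  rw [Set.mem_compl_iff, notMem_support, hf y hy.1, localClass_eq_zero_iff]
  exact hfV y hy.2

theorem nsmul_apply (n : ℕ) (x : X) : (n • D).1 x = n • D.1 x := rfl

/-- A regular local equation `a` is a unit as soon as `a ^ n` is. Without effectivity the class
could be torsion at a non-normal point. -/
theorem IsEffective.nsmul_ne_zero (hD : D.IsEffective) {x : X} (hx : x ∈ D.support) {n : ℕ}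
    (hn : 1 ≤ n) : (n • D).1 x ≠ 0 := by
  obtain ⟨f, hf, a, ha⟩ := hD x
  rw [nsmul_apply, hf, ← localClass_pow, Ne, localClass_eq_zero_iff,
    mem_localUnits_iff_isUnit (a := a ^ n) (by simp [ha]), isUnit_pow_iff (by omega),
    ← mem_localUnits_iff_isUnit ha]
  exact hf.mem_support_iff.1 hx

/-- The subgroup of those divisors in `G` which are trivial at `x`. -/
noncomputable def trivialAt (G : AddSubgroup (CartierDivisor X)) (x : X) : AddSubgroup (CartierDivisor X) :=
  G ⊓ ((Pi.evalAddMonoidHom (fun x : X ↦ LocalDivisor X x) x).comp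
    (cartierDivisors X).subtype).ker

theorem finrank_trivialAt_lt (G : AddSubgroup (CartierDivisor X)) [Module.Finite ℤ G]
    (hG : D ∈ G) (hD : D.IsEffective) {x y : X} (h : x ⤳ y) (hx : x ∉ D.support)
    (hy : y ∈ D.support) :
    Module.finrank ℤ (trivialAt G y) < Module.finrank ℤ (trivialAt G x) := by
  have hle : trivialAt G x ≤ G := inf_le_left
  have hmono : trivialAt G y ≤ trivialAt G x :=
    fun E hE ↦ ⟨hE.1, eq_zero_of_specializes h hE.2⟩
  have hDx : D ∈ trivialAt G x := ⟨hG, notMem_support.1 hx⟩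
  have hDy (n : ℕ) (hn : 1 ≤ n) : n • D ∉ trivialAt G y :=
    fun hmem ↦ hD.nsmul_ne_zero hy hn hmem.2
  have := AddSubgroup.finite_int_of_le (A := CartierDivisor X) hle
  exact AddSubgroup.finrank_lt_of_forall_nsmul_notMem (A := CartierDivisor X) hmono hDx hDy

/-- This settles rank zero in the induction. No relation between `x` and `y` is assumed, so the
comparison is with the divisors trivial at both. -/
theorem finrank_trivialAt_ne_zero (G : AddSubgroup (CartierDivisor X)) [Module.Finite ℤ G]
    (hG : D ∈ G) (hD : D.IsEffective) {x y : X} (hy : y ∈ D.support) (hx : x ∉ D.support) :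
    Module.finrank ℤ (trivialAt G x) ≠ 0 := by
  have hle : trivialAt G x ≤ G := inf_le_left
  have hinf : trivialAt G x ⊓ trivialAt G y ≤ trivialAt G x := inf_le_left
  have hDx : D ∈ trivialAt G x := ⟨hG, notMem_support.1 hx⟩
  have hDy (n : ℕ) (hn : 1 ≤ n) : n • D ∉ trivialAt G x ⊓ trivialAt G y :=
    fun hmem ↦ hD.nsmul_ne_zero hy hn hmem.2.2
  have := AddSubgroup.finite_int_of_le (A := CartierDivisor X) hle
  exact (AddSubgroup.finrank_lt_of_forall_nsmul_notMem (A := CartierDivisor X) hinf hDx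
    hDy).ne_bot

end CartierDivisor
end

/-! ### Gluing rational functions; closures of points as integral subschemes. -/

namespace AlgebraicGeometry.Scheme

theorem genericPoint_mem {X : Scheme.{u}} [IrreducibleSpace X] {U : X.Opens} {x : X} (h : x ∈ U) :
    genericPoint X ∈ U :=
  ((genericPoint_spec X).mem_open_set_iff U.2).2 ⟨x, trivial, h⟩

theorem exists_germ_genericPoint_eq {X : Scheme.{u}} [IsIntegral X] {V : X.Opens}
    (hV : genericPoint X ∈ V) {s : X.functionField}
    (hs : ∀ x ∈ V, s ∈ (algebraMap (X.presheaf.stalk x) X.functionField).range) :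
    ∃ t : Γ(X, V), X.presheaf.germ V (genericPoint X) hV t = s := by
  have key (x : V) : ∃ (U : X.Opens) (hx : x.1 ∈ U) (_ : U ≤ V) (t : Γ(X, U)),
      X.presheaf.germ U (genericPoint X) (genericPoint_mem hx) t = s := by
    obtain ⟨a, ha⟩ := hs x.1 x.2
    obtain ⟨W, hxW, t, rfl⟩ := X.presheaf.exists_germ_eq a
    refine ⟨W ⊓ V, ⟨hxW, x.2⟩, inf_le_right, X.presheaf.map (homOfLE inf_le_left).op t, ?_⟩
    have : Nonempty W := ⟨⟨_, hxW⟩⟩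
    rw [X.presheaf.germ_res_apply, ← ha, algebraMap_germ_eq_germToFunctionField]
  choose U hxU hUV t ht using key
  obtain ⟨g, hg, -⟩ := X.sheaf.existsUnique_gluing' U V (fun i ↦ homOfLE (hUV i))
    (fun x hx ↦ TopologicalSpace.Opens.mem_iSup.2 ⟨⟨x, hx⟩, hxU ⟨x, hx⟩⟩) t (by
      intro i j
      apply germ_injective_of_isIntegral X (genericPoint X)
        (⟨genericPoint_mem (hxU i), genericPoint_mem (hxU j)⟩ : genericPoint X ∈ U i ⊓ U j)
      erw [X.presheaf.germ_res_apply, X.presheaf.germ_res_apply]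
      rw [ht, ht])
  refine ⟨g, ?_⟩
  rw [← ht ⟨_, hV⟩, ← hg ⟨_, hV⟩]
  exact (X.presheaf.germ_res_apply (homOfLE (hUV ⟨_, hV⟩)) _ _ g).symm

/-- The scheme-theoretic image of a point inherits reducedness and irreducibility from `Spec` of the
residue field. -/
theorem isIntegral_image_fromSpecResidueField (X : Scheme.{u}) [QuasiSeparatedSpace X] (x : X) :
    IsIntegral (X.fromSpecResidueField x).image := by
  let f := X.fromSpecResidueField x
  have hf : QuasiCompact f := inferInstance
  have : IsSchemeTheoreticallyDominant f.toImage := by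
    refine ⟨IdealSheafData.ext_of_iSup_eq_top
      (fun U : X.affineOpens ↦ ⟨f.imageι ⁻¹ᵁ U.1, U.2.preimage f.imageι⟩) ?_ fun U ↦ ?_⟩
    · rw [← Hom.preimage_iSup, iSup_affineOpens_eq_top, Hom.preimage_top]
    · rw [Hom.ker_apply, IdealSheafData.ideal_bot]
      exact (RingHom.injective_iff_ker_eq_bot _).1 (f.toImage_app_injective U)
  have : IsReduced f.image := IsSchemeTheoreticallyDominant.isReduced f.toImage
  have : IrreducibleSpace f.image := by
    have := (IrreducibleSpace.isIrreducible_univ (Spec (X.residueField x))).image f.toImage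
      f.toImage.continuous.continuousOn
    have h2 := this.closure
    rw [Set.image_univ, f.toImage.denseRange.closure_range] at h2
    exact irreducibleSpace_def _ |>.2 h2
  exact isIntegral_of_irreducibleSpace_of_isReduced _

theorem range_imageι_fromSpecResidueField (X : Scheme.{u}) [QuasiSeparatedSpace X] (x : X) :
    Set.range (X.fromSpecResidueField x).imageι = closure {x} := by
  let f := X.fromSpecResidueField x
  have hf : QuasiCompact f := inferInstance
  rw [← X.range_fromSpecResidueField x]
  exact IdealSheafData.range_subschemeι _ |>.trans f.support_ker

theorem subsingleton_of_isAffine_of_isField {Z : Scheme.{u}} [IsAffine Z]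
    (h : IsField Γ(Z, ⊤)) : Subsingleton Z := by
  let := h.toField
  have : Subsingleton (Spec Γ(Z, ⊤)) := inferInstanceAs (Subsingleton (PrimeSpectrum Γ(Z, ⊤)))
  exact Z.isoSpec.schemeIsoToHomeo.injective.subsingleton

/-- On a universally closed integral scheme over a field, a global function which does not vanish
identically does not vanish anywhere. -/
theorem basicOpen_eq_top_of_nonempty {k : Type u} [Field k] {Z : Scheme.{u}} [IsIntegral Z]
    (π : Z ⟶ Spec (CommRingCat.of k)) [UniversallyClosed π] (s : Γ(Z, ⊤)) {z : Z}
    (hz : z ∈ Z.basicOpen s) : Z.basicOpen s = ⊤ := by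
  have h := isField_of_universallyClosed k π
  have hs : s ≠ 0 := by
    rintro rfl
    simp at hz
  let := h.toField
  exact Z.basicOpen_of_isUnit hs.isUnit

end AlgebraicGeometry.Scheme

/-! ### Ample divisors meet positive-dimensional closed sets. -/

namespace CartierDivisor
variable {X : Scheme.{u}} [IsIntegral X] {D : CartierDivisor X}

theorem IsAmple.exists_mem_support {k : Type u} [Field k] (π : X ⟶ Spec (CommRingCat.of k))
    [IsProper π] [QuasiSeparatedSpace X] (hD : D.IsAmple) {x : X} (hx : ¬ IsMin x) :
    ∃ y ≤ x, y ∈ D.support := by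
  by_contra! hsupp
  let V : X.Opens := ⟨D.supportᶜ, D.isClosed_support.isOpen_compl⟩
  let i := (X.fromSpecResidueField x).imageι
  let Z := (X.fromSpecResidueField x).image
  have hZ : IsIntegral Z := Scheme.isIntegral_image_fromSpecResidueField X x
  have hri : Set.range i = closure {x} := Scheme.range_imageι_fromSpecResidueField X x
  have hle (z : Z) : i z ≤ x :=
    specializes_iff_mem_closure.2 (hri ▸ Set.mem_range_self z)
  have hiV : i ⁻¹ᵁ V = ⊤ := top_le_iff.1 fun z _ ↦ hsupp _ (hle z)
  obtain ⟨z, hz⟩ : x ∈ Set.range i := hri ▸ subset_closure rfl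
  have hxV : x ∈ V := hsupp x le_rfl
  obtain ⟨n, s, U, hn, hs, hU, hUa, hxU⟩ := hD x
  -- Off the support `𝒪(nD)` is trivial, so `s` becomes a regular function `t` on `V`, with
  -- nonvanishing locus `U ∩ V`.
  have hnD (y : X) (hy : y ∈ V) : (n • D).IsLocalEquation y 1 := by
    have : D.1 y = localClass y 1 := notMem_support.1 hy
    rw [IsLocalEquation, nsmul_apply, this, ← localClass_pow, one_pow]
  obtain ⟨t, ht⟩ := Scheme.exists_germ_genericPoint_eq (Scheme.genericPoint_mem hxV) (s := s)
    fun y hy ↦ by simpa using hs y 1 (hnD y hy)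
  have : Nonempty V := ⟨⟨x, hxV⟩⟩
  have htU (y : X) (hy : y ∈ V) : y ∈ X.basicOpen t ↔ y ∈ U := by
    have hyt : algebraMap (X.presheaf.stalk y) X.functionField (X.presheaf.germ V y hy t) = s := by
      rw [Scheme.algebraMap_germ_eq_germToFunctionField, ← ht]
    rw [Scheme.mem_basicOpen _ _ _ hy, ← SetLike.mem_coe, hU]
    constructor
    · rintro ⟨v, hv⟩ f hf
      obtain ⟨w, hw⟩ := localClass_eq_zero_iff.1 (hf.symm.trans (hnD y hy))
      refine ⟨v * w, ?_⟩
      rw [Units.val_mul, map_mul, hv, hyt, ← hw]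
      rfl
    · intro h
      obtain ⟨v, hv⟩ := h 1 (hnD y hy)
      rw [Units.val_one, mul_one, ← hyt] at hv
      exact ⟨v, algebraMap_stalk_injective y hv⟩
  let t' : Γ(Z, ⊤) := Z.presheaf.map (eqToHom hiV.symm).op (i.app V t)
  have hb : Z.basicOpen t' = i ⁻¹ᵁ X.basicOpen t := by
    rw [Scheme.basicOpen_res_eq, Scheme.preimage_basicOpen]
  -- `Z` is proper and integral and `t'` is nonzero at its generic point, so `t'` vanishes nowhere
  -- and `Z` lies over the affine `U`.
  have htop : Z.basicOpen t' = ⊤ := by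
    refine Scheme.basicOpen_eq_top_of_nonempty (i ≫ π) t' (z := z) ?_
    rw [hb]
    change i z ∈ X.basicOpen t
    rw [hz]
    exact (htU x hxV).2 hxU
  have hiU : i ⁻¹ᵁ U = ⊤ := by
    refine top_le_iff.1 fun y _ ↦ ?_
    have : y ∈ i ⁻¹ᵁ X.basicOpen t := by rw [← hb, htop]; trivial
    exact (htU _ (hsupp _ (hle y))).1 this
  have hZa : IsAffine Z := by
    have := hUa.preimage i
    rw [hiU] at this
    exact (have : IsAffine _ := this; .of_isIso Z.topIso.inv)
  have := Scheme.subsingleton_of_isAffine_of_isField (isField_of_universallyClosed k (i ≫ π))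
  refine hx fun y hy ↦ ?_
  obtain ⟨z', rfl⟩ : y ∈ Set.range i := hri ▸ specializes_iff_mem_closure.1 hy
  exact specializes_of_eq ((congrArg i (Subsingleton.elim z' z)).trans hz)

end CartierDivisor

/-! ### Dimension drops by at most one on a support. -/

theorem AlgebraicGeometry.Scheme.fromSpecStalk_le_iff {X : Scheme.{u}} {x : X}
    {p q : Spec (X.presheaf.stalk x)} :
    X.fromSpecStalk x p ≤ X.fromSpecStalk x q ↔ p ≤ q :=
  (X.fromSpecStalk x).isEmbedding.isInducing.specializes_iff

theorem AlgebraicGeometry.Scheme.fromSpecStalk_lt_iff {X : Scheme.{u}} {x : X}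
    {p q : Spec (X.presheaf.stalk x)} :
    X.fromSpecStalk x p < X.fromSpecStalk x q ↔ p < q := by
  simp only [lt_iff_le_not_ge, fromSpecStalk_le_iff]

namespace CartierDivisor
variable {X : Scheme.{u}} [IsIntegral X] {D : CartierDivisor X}

theorem IsLocalEquation.fromSpecStalk_mem_support {y : X} {f : (X.functionField)ˣ}
    (hf : D.IsLocalEquation y f) {a : X.presheaf.stalk y}
    (ha : algebraMap (X.presheaf.stalk y) X.functionField a = f)
    {q : Spec (X.presheaf.stalk y)} (haq : a ∈ q.asIdeal) :
    X.fromSpecStalk y q ∈ D.support := by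
  have h : X.fromSpecStalk y q ⤳ y := by
    have : X.fromSpecStalk y q ∈ Set.range (X.fromSpecStalk y) := ⟨q, rfl⟩
    rwa [Scheme.range_fromSpecStalk] at this
  rw [(hf.of_specializes h).mem_support_iff,
    mem_localUnits_iff_isUnit ((algebraMap_stalkSpecializes h a).trans ha)]
  have hq : Spec.map (X.presheaf.stalkSpecializes h)
      (IsLocalRing.closedPoint (X.presheaf.stalk (X.fromSpecStalk y q))) = q := by
    apply (X.fromSpecStalk y).isEmbedding.injective
    refine (Scheme.Hom.comp_apply _ _ _).symm.trans ?_
    rw [Scheme.SpecMap_stalkSpecializes_fromSpecStalk]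
    exact Scheme.fromSpecStalk_closedPoint
  rw [← hq] at haq
  exact haq

/-- A chain below `w` is modified to start at a point `y` of the support. Krull's theorem then
applies in the local ring at `y`, so no catenarity is needed. -/
theorem IsEffective.exists_le_height [IsLocallyNoetherian X] (hD : D.IsEffective)
    (hmeet : ∀ x : X, ¬ IsMin x → ∃ y ≤ x, y ∈ D.support) {w : X} {n : ℕ}
    (hn : (n : ℕ∞) + 1 ≤ Order.height w) :
    ∃ w' ≤ w, w' ∈ D.support ∧ (n : ℕ∞) ≤ Order.height w' := by
  obtain ⟨⟨m, p, hp⟩, rfl, hpn⟩ :=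
    Order.exists_series_of_le_height w (n := n + 1) (by exact_mod_cast hn)
  obtain rfl : m = n + 1 := hpn
  have hps : StrictMono p := LTSeries.strictMono ⟨n + 1, p, hp⟩
  have h01 : p 0 < p 1 := hps (by simp)
  -- Strictness keeps the chain's length: if `p 1` itself lies on the closed support, so does `p 0`.
  obtain ⟨y, hy1, hyD⟩ : ∃ y < p 1, y ∈ D.support := by
    obtain ⟨y, hy, hyD⟩ := hmeet (p 1) h01.not_isMin
    by_cases h : p 1 ≤ y
    · exact ⟨p 0, h01, Specializes.mem_closed (h01.le.trans h : p 0 ≤ y) D.isClosed_support hyD⟩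
    · exact ⟨y, lt_of_le_not_ge hy h, hyD⟩
  have hq (i : Fin (n + 1)) : ∃ q, X.fromSpecStalk y q = p i.succ := by
    have h : p i.succ ∈ {z | z ⤳ y} := hy1.le.trans
      (hps.monotone (Fin.succ_zero_eq_one ▸ Fin.succ_le_succ_iff.2 (Fin.zero_le i)))
    rwa [← Scheme.range_fromSpecStalk] at h
  choose q hq using hq
  let r : LTSeries (Spec (X.presheaf.stalk y)) :=
    ⟨n, q, fun i ↦ Scheme.fromSpecStalk_lt_iff.1 (by
      rw [hq, hq]; exact hps (by simp))⟩
  let c : Spec (X.presheaf.stalk y) := IsLocalRing.closedPoint (X.presheaf.stalk y)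
  have hc : c < r.head := Scheme.fromSpecStalk_lt_iff.1 (by
    change X.fromSpecStalk y (IsLocalRing.closedPoint _) < X.fromSpecStalk y (q 0)
    rw [hq, Scheme.fromSpecStalk_closedPoint]
    exact hy1)
  have hr : (n : ℕ∞) + 1 ≤ Order.height (q (Fin.last n)) := by
    have := Order.length_le_height (p := r.cons c hc) (x := q (Fin.last n))
      (by rw [RelSeries.last_cons]; rfl)
    rwa [RelSeries.cons_length, Nat.cast_add, Nat.cast_one] at this
  obtain ⟨f, hf, a, ha⟩ := hD y
  have ham : a ∈ IsLocalRing.maximalIdeal (X.presheaf.stalk y) := by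
    rw [IsLocalRing.mem_maximalIdeal, mem_nonunits_iff, ← mem_localUnits_iff_isUnit ha]
    exact hf.mem_support_iff.1 hyD
  -- The specialization order on `Spec` reverses inclusion of primes.
  have hcoh (x : Spec (X.presheaf.stalk y)) :
      Order.height x = Order.coheight (α := PrimeSpectrum (X.presheaf.stalk y)) x :=
    (Order.height_orderIso (specOrderIsoPrimeSpectrum (X.presheaf.stalk y)) x).symm
  obtain ⟨Q, hPQ, haQ, hQ⟩ := IsLocalRing.exists_le_coheight_of_mem
    (A := X.presheaf.stalk y) (q (Fin.last n)) (hcoh _ ▸ hr) ham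
  refine ⟨X.fromSpecStalk y Q, ?_, hf.fromSpecStalk_mem_support ha haQ, ?_⟩
  · change _ ≤ p (Fin.last n).succ
    rw [← hq]
    refine Scheme.fromSpecStalk_le_iff.2 ?_
    exact (PrimeSpectrum.le_iff_specializes _ _).1 hPQ
  · refine (hQ.trans (hcoh Q).ge).trans ?_
    exact Order.height_le_height_apply_of_strictMono (X.fromSpecStalk y)
      (fun _ _ h ↦ Scheme.fromSpecStalk_lt_iff.2 h) Q

/-! ### The induction on rank, and the passage from Krull dimension to height. -/

theorem exists_mem_iInter_support [IsLocallyNoetherian X] {ι : Type*}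
    {D : ι → CartierDivisor X} {G : AddSubgroup (CartierDivisor X)} [Module.Finite ℤ G]
    (hG : ∀ i, D i ∈ G) (heff : ∀ i, (D i).IsEffective)
    (hmeet : ∀ i, ∀ x : X, ¬ IsMin x → ∃ y ≤ x, y ∈ (D i).support)
    (hX : ¬ IsMin (genericPoint X)) (w : X)
    (hw : (Module.finrank ℤ (trivialAt G w) : ℕ∞) ≤ Order.height w) :
    ∃ y ≤ w, y ∈ ⋂ i, (D i).support := by
  induction hr : Module.finrank ℤ (trivialAt G w) using Nat.strong_induction_on generalizing w with
  | _ r ih =>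
    by_cases h : w ∈ ⋂ i, (D i).support
    · exact ⟨w, le_rfl, h⟩
    obtain ⟨i, hi⟩ : ∃ i, w ∉ (D i).support := by simpa using h
    have hpos : r ≠ 0 := by
      rintro rfl
      obtain ⟨z, -, hz⟩ := hmeet i _ hX
      exact finrank_trivialAt_ne_zero G (hG i) (heff i) hz hi hr
    obtain ⟨n, rfl⟩ := Nat.exists_eq_succ_of_ne_zero hpos
    rw [hr] at hw
    obtain ⟨w', hw', hD, hn⟩ := (heff i).exists_le_height (hmeet i) (w := w) (n := n)
      (by exact_mod_cast hw)
    have hlt := finrank_trivialAt_lt G (hG i) (heff i) hw' hi hD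
    rw [hr] at hlt
    obtain ⟨y, hy, hyD⟩ := ih _ hlt w' (le_trans (by exact_mod_cast Nat.lt_succ_iff.1 hlt) hn) rfl
    exact ⟨y, hy.trans hw', hyD⟩

end CartierDivisor

/-- Taking generic points turns a chain of irreducible closed subsets of `W` into a chain of points
below `w`. -/
theorem AlgebraicGeometry.Scheme.exists_closure_eq_and_le_height {X : Scheme.{u}} {W : Set X}
    (hW : IsClosed W) (hWi : IsIrreducible W) {n : ℕ}
    (hn : (n : WithBot ℕ∞) ≤ topologicalKrullDim W) :
    ∃ w : X, closure {w} = W ∧ (n : ℕ∞) ≤ Order.height w := by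
  obtain ⟨w, hw⟩ := QuasiSober.sober hWi hW
  refine ⟨w, hw, ?_⟩
  obtain ⟨l, rfl⟩ := Order.le_krullDim_iff.1 hn
  let g : TopologicalSpace.IrreducibleCloseds W → X := fun Z ↦
    (TopologicalSpace.IrreducibleCloseds.map Subtype.val continuous_subtype_val Z).2.genericPoint
  have hg (Z) : closure {g Z} =
      (TopologicalSpace.IrreducibleCloseds.map Subtype.val continuous_subtype_val Z : Set X) := by
    rw [IsIrreducible.genericPoint_closure_eq]
    exact (TopologicalSpace.IrreducibleCloseds.map _ _ Z).isClosed.closure_eq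
  have hgm {Z Z'} : g Z ≤ g Z' ↔
      TopologicalSpace.IrreducibleCloseds.map Subtype.val continuous_subtype_val Z ≤
      TopologicalSpace.IrreducibleCloseds.map Subtype.val continuous_subtype_val Z' := by
    refine specializes_iff_closure_subset.trans ?_
    rw [hg, hg]
    exact SetLike.coe_subset_coe
  have hgs : StrictMono g := fun Z Z' h ↦ by
    have := TopologicalSpace.IrreducibleCloseds.map_strictMono_of_isInducing
      (f := (Subtype.val : W → X)) .subtypeVal h
    rw [lt_iff_le_not_ge, hgm, hgm]
    exact lt_iff_le_not_ge.1 this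
  refine Order.length_le_height (p := l.map g hgs) (specializes_iff_mem_closure.2 ?_)
  rw [hw.def]
  have : g l.last ∈ closure {g l.last} := subset_closure rfl
  rw [hg] at this
  refine closure_minimal ?_ hW this
  rintro _ ⟨z, -, rfl⟩
  exact z.2

theorem mainTheorem9 {k : Type u} [Field k] (X : Scheme.{u}) [IsIntegral X]
    (π : X ⟶ Spec (CommRingCat.of k)) (hX : IsProjectiveOver π)
    (hdim : 0 < topologicalKrullDim X)
    {q : ℕ} (D : Fin q → CartierDivisor X)
    (hample : ∀ i, (D i).IsAmple) (heff : ∀ i, (D i).IsEffective) :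
    (∀ W : Set X, IsClosed W → IsIrreducible W →
      (CartierDivisor.rk D : WithBot ℕ∞) ≤ topologicalKrullDim W →
        ((⋂ i, (D i).support) ∩ W).Nonempty) ∧
    ((CartierDivisor.rk D : WithBot ℕ∞) ≤ topologicalKrullDim X →
      (⋂ i, (D i).support).Nonempty) := by
  have hdimuniv : topologicalKrullDim (Set.univ : Set X) = topologicalKrullDim X :=
    (Homeomorph.Set.univ X).isHomeomorph.topologicalKrullDim_eq _
  have hproper : IsProper π := hX.isProper
  have hnoeth : IsLocallyNoetherian X := LocallyOfFiniteType.isLocallyNoetherian π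
  have hirr : IsIrreducible (Set.univ : Set X) := IrreducibleSpace.isIrreducible_univ X
  -- Positive dimension makes every support nonempty, as the rank-zero case requires.
  have hgen : ¬ IsMin (genericPoint X) := by
    obtain ⟨w, hw, hw1⟩ := Scheme.exists_closure_eq_and_le_height isClosed_univ hirr (n := 1) <| by
      rw [hdimuniv]
      exact Order.one_le_krullDim_iff.2 (Order.krullDim_pos_iff.1 hdim)
    have hwmin : ¬ IsMin w := Order.height_ne_zero.1 fun h ↦ by simp [h] at hw1
    rwa [(genericPoint_spec X).eq hw]
  let G := AddSubgroup.closure (Set.range D)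
  have hfin : Module.Finite ℤ G :=
    Module.Finite.iff_addGroup_fg.2 ((AddGroup.fg_iff_addSubgroup_fg _).2
      ⟨(Set.finite_range D).toFinset, by simp [G]⟩)
  have key : ∀ W : Set X, IsClosed W → IsIrreducible W →
      (CartierDivisor.rk D : WithBot ℕ∞) ≤ topologicalKrullDim W →
        ((⋂ i, (D i).support) ∩ W).Nonempty := by
    intro W hW hWi hr
    obtain ⟨w, rfl, hw⟩ := Scheme.exists_closure_eq_and_le_height hW hWi hr
    have hle : CartierDivisor.trivialAt G w ≤ G := inf_le_left
    have hrank : Module.finrank ℤ (CartierDivisor.trivialAt G w) ≤ CartierDivisor.rk D :=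
      AddSubgroup.finrank_int_le_of_le (A := CartierDivisor X) hle
    obtain ⟨y, hy, hyD⟩ := CartierDivisor.exists_mem_iInter_support (D := D) (G := G)
      (fun i ↦ AddSubgroup.subset_closure ⟨i, rfl⟩) heff
      (fun i x hx ↦ (hample i).exists_mem_support π hx) hgen w
      (le_trans (by exact_mod_cast hrank) hw)
    exact ⟨y, hyD, specializes_iff_mem_closure.1 hy⟩
  refine ⟨key, fun hr ↦ ?_⟩
  simpa using key Set.univ isClosed_univ hirr (by rwa [hdimuniv])
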